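/- Graphs are finite and simple unless stated otherwise, $P_m$ is the path on $m$ vertices, $G+H$ is the join of $G$ and $H$, $G\cup H$ is their disjoint union, $a\cdot G$ is the disjoint union of $a$ copies of $G$, $e(G)$ is the number of edges of $G$, and $\lambda(G)$ is the largest eigenvalue of the adjacency matrix of $G$. For a family $\mathcal F$ of graphs, a graph is $\mathcal F$-free if it has no subgraph (not necessarily induced) isomorphic to a member of $\mathcal F$. Let $\mathrm{EX}(n,\mathcal F)$ and $\mathrm{SPEX}(n,\mathcal F)$ be the sets of $n$-vertex $\mathcal F$-free graphs with the maximum number of edges and with the maximum value of $\lambda$, respectively; let $\mathrm{ex}(n,\mathcal F)$ be the maximum number of edges of an $n$-vertex $\mathcal F$-free graph; and let $\mathrm{EX}^{W}(n,\mathcal F)$ be the set of graphs with the maximum number of edges among the $n$-vertex $\mathcal F$-free graphs that contain a copy of $W$. **Proposition 1.2.** There is a finite family $\mathcal F$ of graphs with the following properties. 1. There is a constant $C$ such that for all sufficiently large $n$, $\mathrm{EX}(n,\mathcal F)$ is nonempty and each of its members is isomorphic to $K_2+X$ for some graph $X$ on $n-2$ vertices with $|e(X)-3n/4|\le C$. For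 all sufficiently large $n\equiv 2\pmod 4$, up to isomorphism, $\mathrm{EX}(n,\mathcal F)$ consists of exactly one graph, $K_2+\left(P_8\cup\frac{n-10}{4}\cdot P_4\right)$. 2. For infinitely many $n$ (indeed for infinitely many $n\equiv 2\pmod 4$), $\mathrm{SPEX}(n,\mathcal F)\cap\mathrm{EX}(n,\mathcal F)=\emptyset$. 3. Consider, for a family $\mathcal F$, an integer $k$ and a real number $Q$, the implication from the hypothesis "$\mathcal F$ is finite, $\mathrm{ex}(n,\mathcal F)=O(n)$, the complete bipartite graph $K_{k+1,\infty}$ with parts of sizes $k+1$ and $\aleph_0$ is not $\mathcal F$-free, and for some constant $C'$ and all sufficiently large $n$ the set $\mathrm{EX}^{K_{k,n-k}}(n,\mathcal F)$ contains a graph of the form $K_k+X$ with $e(X)\le Qn+C'$" to the conclusion "$\mathrm{SPEX}(n,\mathcal F)\subseteq\mathrm{EX}^{K_k+\overline{K_{n-k}}}(n,\mathcal F)$ for all sufficiently large $n$". This implication fails for the above $\mathcal F$ with $k=2$ and $Q=3/4$: the hypothesis holds and the conclusion does not. (Case (d) of Theorem 1.1 is this implication for $0\le Q<3/4$.) -/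

import Mathlib

open Filter Asymptotics SimpleGraph
open scoped Topology

namespace TuranSpectral

/-- A family of finite graphs, each represented on a vertex set `Fin m`. -/
abbrev GraphFamily : Type := Set (Σ m : ℕ, SimpleGraph (Fin m))

/-- The join `G + H`: disjoint copies of `G` and `H` and all edges between them. -/
def join {V W : Type} (G : SimpleGraph V) (H : SimpleGraph W) : SimpleGraph (V ⊕ W) :=
  (G ⊕g H) ⊔ completeBipartiteGraph V W

/-- The disjoint union `a · G` of `a` copies of `G`. -/
def copies {V : Type} (a : ℕ) (G : SimpleGraph V) : SimpleGraph (Fin a × V) where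
  Adj p q := p.1 = q.1 ∧ G.Adj p.2 q.2
  symm := ⟨fun _ _ h => ⟨h.1.symm, h.2.symm⟩⟩
  loopless := ⟨fun _ h => G.irrefl h.2⟩

/-- The number of edges `e(G)` of a graph. -/
noncomputable def numEdges {V : Type} (G : SimpleGraph V) : ℕ := G.edgeSet.ncard

/-- `G` is `𝓕`-free: no member of `𝓕` is a (not necessarily induced) subgraph of `G`. -/
def FamilyFree (𝓕 : GraphFamily) {V : Type} (G : SimpleGraph V) : Prop :=
  ∀ F ∈ 𝓕, F.2.Free G

/-- The largest eigenvalue `λ(G)` of the adjacency matrix of a finite graph. -/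
noncomputable def lam {V : Type} [Fintype V] (G : SimpleGraph V) : ℝ :=
  open scoped Classical in sSup (spectrum ℝ (G.adjMatrix ℝ))

/-- `ex(n, 𝓕)`: the maximum number of edges of an `𝓕`-free graph on `n` vertices. -/
noncomputable def ex (n : ℕ) (𝓕 : GraphFamily) : ℕ :=
  open scoped Classical in
  Finset.sup (Finset.univ.filter fun G : SimpleGraph (Fin n) => FamilyFree 𝓕 G) numEdges

/-- `EX(n, 𝓕)`: the `𝓕`-free graphs on `n` labelled vertices with the maximum number of edges. -/
def EX (n : ℕ) (𝓕 : GraphFamily) : Set (SimpleGraph (Fin n)) :=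
  {G | FamilyFree 𝓕 G ∧
    ∀ G' : SimpleGraph (Fin n), FamilyFree 𝓕 G' → numEdges G' ≤ numEdges G}

/-- `EX^W(n, 𝓕)`: the graphs with the maximum number of edges among the `𝓕`-free graphs on `n`
labelled vertices that contain a copy of `W`. -/
def EXContaining {U : Type} (W : SimpleGraph U) (n : ℕ) (𝓕 : GraphFamily) :
    Set (SimpleGraph (Fin n)) :=
  {G | (FamilyFree 𝓕 G ∧ W ⊑ G) ∧
    ∀ G' : SimpleGraph (Fin n), FamilyFree 𝓕 G' → W ⊑ G' → numEdges G' ≤ numEdges G}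

/-- `SPEX(n, 𝓕)`: the `𝓕`-free graphs on `n` labelled vertices with the maximum `λ`. -/
def SPEX (n : ℕ) (𝓕 : GraphFamily) : Set (SimpleGraph (Fin n)) :=
  {G | FamilyFree 𝓕 G ∧ ∀ G' : SimpleGraph (Fin n), FamilyFree 𝓕 G' → lam G' ≤ lam G}

/-- The condition: `𝓕` is finite, `ex(n, 𝓕) = O(n)`, `K_{k+1,∞}` is not `𝓕`-free, and for all
large `n` some graph in `EX^{K_{k,n-k}}(n, 𝓕)` has the form `K_k + X` with `e(X) ≤ Qn + O(1)`. -/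
def HasLinearJoinExtremal (𝓕 : GraphFamily) (k : ℕ) (Q : ℝ) : Prop :=
  𝓕.Finite ∧
  (fun n : ℕ => (ex n 𝓕 : ℝ)) =O[atTop] (fun n : ℕ => (n : ℝ)) ∧
  ¬ FamilyFree 𝓕 (completeBipartiteGraph (Fin (k + 1)) ℕ) ∧
  ∃ C : ℝ, ∀ᶠ n : ℕ in atTop,
    ∃ H ∈ EXContaining (completeBipartiteGraph (Fin k) (Fin (n - k))) n 𝓕,
      ∃ X : SimpleGraph (Fin (n - k)),
        Nonempty (H ≃g join (completeGraph (Fin k)) X) ∧ (numEdges X : ℝ) ≤ Q * n + C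

/-- The conclusion: for all large `n`, every graph in `SPEX(n, 𝓕)` has the maximum number of edges
among the `n`-vertex `𝓕`-free graphs that contain the join of `K_k` and `n - k` isolated
vertices. -/
def SpexSubsetEventually (𝓕 : GraphFamily) (k : ℕ) : Prop :=
  ∀ᶠ n : ℕ in atTop,
    SPEX n 𝓕 ⊆
      EXContaining (join (completeGraph (Fin k)) (emptyGraph (Fin (n - k)))) n 𝓕

end TuranSpectral

/-!
Call a graph admissible if it is a subgraph of some `P_8 ∪ a · P_4` or of some `b · K_{1,3}`, and
let `𝓕` be a family of obstructions to becoming admissible after the deletion of at most two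
vertices. Every graph with such an obstruction has one of bounded order, so `𝓕` can be taken finite.
When `4 ∣ m ≥ 8`, an admissible graph on `m` vertices has at most `3m/4 + 1` edges, with equality
only for `P_8 ∪ a · P_4`, because every component of a forest costs an edge; the stars
`b · K_{1,3}` have one edge less.

The largest eigenvalue `μ ~ √(2m)` of `K_2 + X` is governed by the number of walks in `X`, those of
length `l` entering with weight `μ^{-l}`. Losing an edge costs `2/μ`, but `b · K_{1,3}` has linearly
more walks of length two than `P_8 ∪ a · P_4` (12 rather than 10 on four vertices), which gains a
positive constant. So for large `m` the stars have fewer edges and the larger eigenvalue.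
-/

namespace TuranSpectral

/-- Restriction of the codomain of a copy of `G` in `H` to a vertex set containing it. -/
def copyCodRestrict {V W : Type} {G : SimpleGraph V} {H : SimpleGraph W} (f : Copy G H) (T : Set W)
    (hT : ∀ v, f v ∈ T) : Copy G (H.induce T) :=
  ⟨⟨fun v => ⟨f v, hT v⟩, fun h => f.toHom.map_adj h⟩,
    fun _ _ h => f.injective (congrArg Subtype.val h)⟩

lemma induce_isContained_induce {V W : Type} {G : SimpleGraph V} {H : SimpleGraph W} (f : Copy G H)
    {S : Set V} {T : Set W} (h : Set.MapsTo f S T) : G.induce S ⊑ H.induce T :=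
  ⟨copyCodRestrict (f.comp (Copy.induce G S)) T fun v => h v.2⟩

/-- A property of graphs (on vertex types in the lowest universe). -/
abbrev GraphProperty : Type 1 := ∀ ⦃V : Type⦄, SimpleGraph V → Prop

/-- The property passes to (not necessarily induced) subgraphs. -/
def IsMonotone (P : GraphProperty) : Prop :=
  ∀ ⦃V W : Type⦄ ⦃G : SimpleGraph V⦄ ⦃H : SimpleGraph W⦄, G ⊑ H → P H → P G

/-- The property of a finite graph can be checked on its induced subgraphs with at most `r`
vertices. -/
def IsLocal (P : GraphProperty) (r : ℕ) : Prop :=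
  ∀ ⦃V : Type⦄ [Finite V] (G : SimpleGraph V),
    (∀ T : Finset V, T.card ≤ r → P (G.induce (T : Set V))) → P G

/-- A family of forbidden subgraphs characterizing the property among finite graphs. -/
def IsObstructionFamily (𝓕 : GraphFamily) (P : GraphProperty) : Prop :=
  ∀ ⦃V : Type⦄ [Finite V] (G : SimpleGraph V), FamilyFree 𝓕 G ↔ P G

section Obstructions

variable {P Q : GraphProperty} {r s k : ℕ}

theorem exists_finite_isObstructionFamily (hP : IsMonotone P) (hr : IsLocal P r) :
    ∃ 𝓕 : GraphFamily, 𝓕.Finite ∧ IsObstructionFamily 𝓕 P := by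
  refine ⟨{F | F.1 ≤ r ∧ ¬ P F.2}, ?_, fun V _ G => ⟨fun h => hr G fun T hT => ?_, ?_⟩⟩
  · refine ((Set.finite_Iic r).biUnion fun m _ =>
      Set.finite_range (Sigma.mk (β := fun m => SimpleGraph (Fin m)) m)).subset ?_
    rintro ⟨m, F⟩ ⟨hm, -⟩
    exact Set.mem_biUnion (Set.mem_Iic.mpr hm) ⟨F, rfl⟩
  · by_contra hPT
    let e : (G.induce (T : Set V)).comap T.equivFin.symm ≃g G.induce (T : Set V) := Iso.comap _ _
    exact h ⟨T.card, _⟩ ⟨hT, fun hF => hPT (hP e.isContained' hF)⟩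
      (e.isContained.trans ⟨Copy.induce G _⟩)
  · exact fun hG F hF hFG => hF.2 (hP hFG hG)

lemma IsMonotone.or (hP : IsMonotone P) (hQ : IsMonotone Q) : IsMonotone fun _ G => P G ∨ Q G :=
  fun _ _ _ _ h => Or.imp (hP h) (hQ h)

lemma IsLocal.or (hP : IsLocal P r) (hQ : IsLocal Q s) (hPm : IsMonotone P) (hQm : IsMonotone Q) :
    IsLocal (fun _ G => P G ∨ Q G) (r + s) := by
  classical
  intro V _ G h
  by_contra! ⟨hPG, hQG⟩
  obtain ⟨S, hS, hPS⟩ : ∃ S : Finset V, S.card ≤ r ∧ ¬ P (G.induce (S : Set V)) := by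
    by_contra! hc
    exact hPG (hP G hc)
  obtain ⟨T, hT, hQT⟩ : ∃ T : Finset V, T.card ≤ s ∧ ¬ Q (G.induce (T : Set V)) := by
    by_contra! hc
    exact hQG (hQ G hc)
  have hsub {U : Finset V} (hU : U ⊆ S ∪ T) :
      G.induce (U : Set V) ⊑ G.induce ((S ∪ T : Finset V) : Set V) :=
    induce_isContained_induce (.id G) (Finset.coe_subset.mpr hU)
  rcases h (S ∪ T) ((Finset.card_union_le S T).trans (by gcongr)) with h | h
  · exact hPS (hPm (hsub Finset.subset_union_left) h)
  · exact hQT (hQm (hsub Finset.subset_union_right) h)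

/-- The union of `W` over a branching of depth `k + 1`: pick a member, guess which of its vertices
lies in the set to be avoided, and recurse on the members avoiding that vertex. -/
lemma exists_card_le_forall_exists_disjoint {α : Type*} (𝓗 : Set (Finset α))
    (hr : ∀ H ∈ 𝓗, H.card ≤ r) (h : ∀ S : Finset α, S.card ≤ k → ∃ H ∈ 𝓗, Disjoint H S) :
    ∃ W : Finset α, W.card ≤ (r + 1) ^ (k + 1) ∧
      ∀ S : Finset α, S.card ≤ k → ∃ H ∈ 𝓗, H ⊆ W ∧ Disjoint H S := by
  classical
  induction k generalizing 𝓗 with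
  | zero =>
    obtain ⟨H, hH, -⟩ := h ∅ le_rfl
    refine ⟨H, (hr H hH).trans (by simp), fun S hS => ⟨H, hH, subset_rfl, ?_⟩⟩
    rw [Finset.card_eq_zero.mp (Nat.le_zero.mp hS)]
    exact Finset.disjoint_empty_right H
  | succ k ih =>
    obtain ⟨O, hO, -⟩ := h ∅ (Nat.zero_le _)
    have hbranch (v : α) : ∃ W : Finset α, W.card ≤ (r + 1) ^ (k + 1) ∧
        ∀ S : Finset α, S.card ≤ k → ∃ H ∈ {H ∈ 𝓗 | v ∉ H}, H ⊆ W ∧ Disjoint H S := by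
      refine ih {H ∈ 𝓗 | v ∉ H} (fun H hH => hr H hH.1) fun S hS => ?_
      obtain ⟨H, hH, hd⟩ := h (insert v S) ((Finset.card_insert_le v S).trans (by gcongr))
      rw [Finset.disjoint_insert_right] at hd
      exact ⟨H, ⟨hH, hd.1⟩, hd.2⟩
    choose W hWcard hW using hbranch
    refine ⟨O ∪ O.biUnion W, ?_, fun S hS => ?_⟩
    · calc (O ∪ O.biUnion W).card
          ≤ O.card + O.card * (r + 1) ^ (k + 1) := (Finset.card_union_le _ _).trans
            (by gcongr; exact Finset.card_biUnion_le_card_mul _ _ _ fun v _ => hWcard v)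
        _ ≤ (r + 1) ^ (k + 1) + r * (r + 1) ^ (k + 1) := by
            have := hr O hO
            gcongr
            exact (this.trans r.le_succ).trans (Nat.le_self_pow k.succ_ne_zero _)
        _ = (r + 1) ^ (k + 1 + 1) := by ring
    · by_cases hd : Disjoint O S
      · exact ⟨O, hO, Finset.subset_union_left, hd⟩
      obtain ⟨v, hvO, hvS⟩ := Finset.not_disjoint_iff.mp hd
      obtain ⟨H, ⟨hH, hvH⟩, hHW, hHS⟩ := hW v (S.erase v)
        (by rw [Finset.card_erase_of_mem hvS]; omega)
      refine ⟨H, hH, hHW.trans ((Finset.subset_biUnion_of_mem W hvO).trans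
        Finset.subset_union_right), ?_⟩
      rw [← Finset.insert_erase hvS]
      exact Finset.disjoint_insert_right.mpr ⟨hvH, hHS⟩

/-- The `k`-apex graphs of the property `P`: it holds after deleting at most `k` vertices. -/
def Apex (k : ℕ) (P : GraphProperty) : GraphProperty :=
  fun V G => ∃ S : Finset V, S.card ≤ k ∧ P (G.induce (↑S)ᶜ)

lemma IsMonotone.apex (hP : IsMonotone P) : IsMonotone (Apex k P) := by
  classical
  rintro V W G H ⟨f⟩ ⟨S, hS, hPS⟩
  refine ⟨S.preimage f f.injective.injOn, ?_, hP (induce_isContained_induce f ?_) hPS⟩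
  · exact (Finset.card_le_card_of_injOn f (fun v hv => Finset.mem_preimage.mp hv)
      f.injective.injOn).trans hS
  · simp [Set.MapsTo]

lemma IsLocal.apex (hP : IsMonotone P) (hr : IsLocal P r) :
    IsLocal (Apex k P) ((r + 1) ^ (k + 1)) := by
  intro V _ G h
  by_contra hG
  simp only [Apex, not_exists, not_and] at hG
  have hobs (S : Finset V) (hS : S.card ≤ k) :
      ∃ H ∈ {H : Finset V | H.card ≤ r ∧ ¬ P (G.induce (H : Set V))}, Disjoint H S := by
    by_contra! hc
    refine hG S hS (hr _ fun T hT => ?_)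
    have hTS : Disjoint (T.map (.subtype _)) S := by
      simpa [Finset.disjoint_left] using fun v hv _ => hv
    have hPT : P (G.induce (T.map (.subtype _) : Set V)) := by
      by_contra hPT
      exact hc _ ⟨by simpa using hT, hPT⟩ hTS
    exact hP (induce_isContained_induce (Copy.induce G _)
      fun v hv => by simpa using ⟨v.2, hv⟩) hPT
  obtain ⟨W, hWcard, hW⟩ := exists_card_le_forall_exists_disjoint _ (fun H hH => hH.1) hobs
  obtain ⟨S, hS, hPS⟩ := h W hWcard
  obtain ⟨H, hH, hHW, hHS⟩ := hW (S.map (.subtype _)) (by simpa using hS)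
  refine hH.2 (hP ⟨copyCodRestrict (copyCodRestrict (Copy.induce G H) W fun v => hHW v.2) _ ?_⟩ hPS)
  intro v hv
  exact Finset.disjoint_left.mp hHS v.2 (Finset.mem_map_of_mem _ hv)

end Obstructions

section Edges

variable {V W : Type} {G G' : SimpleGraph V} {H : SimpleGraph W}

lemma numEdges_le_of_isContained [Finite W] (h : G ⊑ H) : numEdges G ≤ numEdges H := by
  obtain ⟨f⟩ := h
  exact Nat.card_le_card_of_injective f.mapEdgeSet f.mapEdgeSet.injective

lemma numEdges_eq_of_iso [Finite V] [Finite W] (e : G ≃g H) : numEdges G = numEdges H :=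
  le_antisymm (numEdges_le_of_isContained e.isContained) (numEdges_le_of_isContained e.isContained')

lemma eq_of_le_of_numEdges_le [Finite V] (h : G ≤ G') (hc : numEdges G' ≤ numEdges G) : G = G' :=
  edgeSet_injective (Set.eq_of_subset_of_ncard_le (edgeSet_mono h) hc)

lemma nonempty_iso_of_isContained [Finite V] [Finite W] (h : G ⊑ H) (hV : Nat.card V = Nat.card W)
    (hc : numEdges H ≤ numEdges G) : Nonempty (G ≃g H) := by
  obtain ⟨f⟩ := h
  let e : V ≃ W := Equiv.ofBijective f
    ((Nat.bijective_iff_injective_and_card f).mpr ⟨f.injective, hV⟩)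
  have heq : G = H.comap e :=
    eq_of_le_of_numEdges_le (fun _ _ hab => f.toHom.map_adj hab)
      (by rwa [numEdges_eq_of_iso (Iso.comap e H)])
  exact ⟨⟨e, fun {a b} => by rw [heq]; rfl⟩⟩

lemma numEdges_add_one_of_isTree [Finite V] (hG : G.IsTree) : numEdges G + 1 = Nat.card V :=
  (isTree_iff_connected_and_card.mp hG).2

lemma numEdges_add_card_connectedComponent_le [Finite V]
    (hG : ∀ C : G.ConnectedComponent, C.toSimpleGraph.IsTree) :
    numEdges G + Nat.card G.ConnectedComponent ≤ Nat.card V := by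
  have := Fintype.ofFinite G.ConnectedComponent
  have hedges : numEdges G ≤ ∑ C : G.ConnectedComponent, numEdges C.toSimpleGraph := by
    have hcover : G.edgeSet ⊆
        ⋃ C : G.ConnectedComponent, Sym2.map Subtype.val '' C.toSimpleGraph.edgeSet := by
      intro e
      induction e with
      | h u v =>
        intro huv
        refine Set.mem_iUnion.mpr ⟨G.connectedComponentMk u, s(⟨u, rfl⟩, ⟨v, ?_⟩), huv, rfl⟩
        exact (ConnectedComponent.connectedComponentMk_eq_of_adj huv).symm
    refine (Set.ncard_le_ncard hcover (Set.toFinite _)).trans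
      ((Set.ncard_iUnion_le_of_fintype _).trans (Finset.sum_le_sum fun C _ => ?_))
    exact Set.ncard_image_le (Set.toFinite _)
  have hverts : Nat.card V = ∑ C : G.ConnectedComponent, Nat.card C := by
    rw [← Nat.card_sigma]
    exact Nat.card_congr (Equiv.sigmaFiberEquiv G.connectedComponentMk).symm
  calc numEdges G + Nat.card G.ConnectedComponent
      ≤ ∑ C : G.ConnectedComponent, (numEdges C.toSimpleGraph + 1) := by
        rw [Finset.sum_add_distrib, Finset.sum_const, Finset.card_univ, smul_eq_mul, mul_one,
          Nat.card_eq_fintype_card]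
        gcongr
    _ = Nat.card V := by
        rw [hverts]
        exact Finset.sum_congr rfl fun C _ =>
          numEdges_add_one_of_isTree (hG C)

lemma two_mul_numEdges_eq_sum_degree [Fintype V] [DecidableRel G.Adj] :
    2 * numEdges G = ∑ v, G.degree v := by
  classical
  rw [sum_degrees_eq_twice_card_edges, numEdges, ← coe_edgeFinset, Set.ncard_coe_finset]

lemma numEdges_sum [Finite V] [Finite W] : numEdges (G ⊕g H) = numEdges G + numEdges H := by
  simp only [numEdges, ← Nat.card_coe_set_eq]
  rw [← Nat.card_sum]
  exact Nat.card_congr edgeSetSumEquiv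

@[simp] lemma copies_adj {a : ℕ} {p q : Fin a × V} :
    (copies a G).Adj p q ↔ p.1 = q.1 ∧ G.Adj p.2 q.2 := Iff.rfl

lemma numEdges_copies [Finite V] (a : ℕ) : numEdges (copies a G) = a * numEdges G := by
  classical
  have := Fintype.ofFinite V
  have hdeg (i : Fin a) (v : V) : (copies a G).degree (i, v) = G.degree v := by
    rw [← card_neighborFinset_eq_degree, ← card_neighborFinset_eq_degree,
      ← Finset.card_map (s := G.neighborFinset v) ⟨Prod.mk i, Prod.mk_right_injective i⟩]
    congr 1
    ext ⟨j, w⟩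
    simp [and_comm]
  refine Nat.eq_of_mul_eq_mul_left two_pos ?_
  rw [two_mul_numEdges_eq_sum_degree, Fintype.sum_prod_type, mul_left_comm,
    two_mul_numEdges_eq_sum_degree]
  simp [hdeg]

lemma numEdges_completeBipartiteGraph [Finite V] [Finite W] :
    numEdges (completeBipartiteGraph V W) = Nat.card V * Nat.card W := by
  simp [numEdges, Set.ncard, encard_edgeSet_completeBipartiteGraph, ENat.card_eq_coe_natCard]

lemma numEdges_join [Finite V] [Finite W] :
    numEdges (join G H) = numEdges G + numEdges H + Nat.card V * Nat.card W := by
  rw [← numEdges_sum, ← numEdges_completeBipartiteGraph, numEdges, join, edgeSet_sup,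
    Set.ncard_union_eq]
  · rfl
  · rw [disjoint_edgeSet, disjoint_iff_inf_le]
    rintro (v | w) (v' | w') h <;> simp at h

end Edges

section Join

variable {V W : Type} {G : SimpleGraph V} {H : SimpleGraph W} {P : GraphProperty} {k : ℕ}

@[simp] lemma join_adj_inl_inl {a b : V} :
    (join G H).Adj (Sum.inl a) (Sum.inl b) ↔ G.Adj a b := by simp [join]

@[simp] lemma join_adj_inr_inr {a b : W} :
    (join G H).Adj (Sum.inr a) (Sum.inr b) ↔ H.Adj a b := by simp [join]

@[simp] lemma join_adj_inl_inr {a : V} {b : W} :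
    (join G H).Adj (Sum.inl a) (Sum.inr b) := by simp [join]

@[simp] lemma join_adj_inr_inl {a : W} {b : V} :
    (join G H).Adj (Sum.inr a) (Sum.inl b) := by simp [join]

lemma apex_join [Fintype V] (hP : IsMonotone P) (h : P H) :
    Apex (Fintype.card V) P (join G H) := by
  refine ⟨Finset.univ.map .inl, by simp, hP ?_ h⟩
  have hr (v : ↥((Finset.univ.map .inl : Finset (V ⊕ W)) : Set (V ⊕ W))ᶜ) :
      ∃ w, Sum.inr w = v.1 := by
    obtain ⟨a | b, hv⟩ := v
    · simp at hv
    · exact ⟨b, rfl⟩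
  choose f hf using hr
  refine ⟨⟨⟨f, fun {a b} hab => ?_⟩, fun a b hab => Subtype.ext ?_⟩⟩
  · rwa [comap_adj, Function.Embedding.subtype_apply, Function.Embedding.subtype_apply, ← hf a,
      ← hf b, join_adj_inr_inr] at hab
  · rw [← hf a, ← hf b]
    exact congrArg Sum.inr hab

lemma exists_join_of_apex [Finite V] (hP : IsMonotone P) (hk : k ≤ Nat.card V) (h : Apex k P G) :
    ∃ X : SimpleGraph (Fin (Nat.card V - k)), P X ∧ G ⊑ join (completeGraph (Fin k)) X := by
  classical
  have := Fintype.ofFinite V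
  obtain ⟨S, hS, hPS⟩ := h
  obtain ⟨T, hST, hT⟩ := Finset.exists_superset_card_eq hS (by rwa [← Nat.card_eq_fintype_card])
  let e₁ : {v // v ∈ T} ≃ Fin k := Fintype.equivFinOfCardEq (by simpa using hT)
  let e₂ : {v // v ∉ T} ≃ Fin (Nat.card V - k) := Fintype.equivFinOfCardEq (by
    rw [Fintype.card_subtype_compl, Fintype.card_coe, hT, Nat.card_eq_fintype_card])
  let e : V ≃ Fin k ⊕ Fin (Nat.card V - k) :=
    (Equiv.sumCompl (· ∈ T)).symm.trans (Equiv.sumCongr e₁ e₂)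
  let X : SimpleGraph (Fin (Nat.card V - k)) := G.comap fun x => e.symm (Sum.inr x)
  refine ⟨X, hP ⟨copyCodRestrict (Embedding.comap ⟨_, ?_⟩ G).toCopy _ fun x hx => ?_⟩ hPS,
    isContained_iff_exists_le_comap.mpr ⟨e.toEmbedding, fun a b hab => ?_⟩⟩
  · exact e.symm.injective.comp Sum.inr_injective
  · exact absurd (hST hx) (show e.symm (Sum.inr x) ∉ T by simpa [e] using (e₂.symm x).2)
  · obtain ⟨a, rfl⟩ := e.symm.surjective a
    obtain ⟨b, rfl⟩ := e.symm.surjective b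
    rw [comap_adj, Equiv.coe_toEmbedding, Equiv.apply_symm_apply, Equiv.apply_symm_apply]
    rcases a with a | a <;> rcases b with b | b
    · rw [join_adj_inl_inl, top_adj]
      rintro rfl
      exact hab.ne rfl
    · exact join_adj_inl_inr
    · exact join_adj_inr_inl
    · exact join_adj_inr_inr.mpr hab

end Join

section SubPackings

variable {β η V : Type} {B : SimpleGraph β} {H : SimpleGraph η} {G : SimpleGraph V}

/-- The subgraphs of the disjoint unions of `B` with copies of `H`. -/
def IsSubPacking (B : SimpleGraph β) (H : SimpleGraph η) : GraphProperty :=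
  fun _ G => ∃ a, G ⊑ B ⊕g copies a H

lemma isMonotone_isSubPacking : IsMonotone (IsSubPacking B H) :=
  fun _ _ _ _ h => Exists.imp fun _ => h.trans

/-- The part of `B ⊕g copies a H` to which a vertex belongs: `none` stands for `B`. -/
def packingPart {a : ℕ} : β ⊕ Fin a × η → Option (Fin a) :=
  Sum.elim (fun _ => none) (fun p => some p.1)

lemma packingPart_eq_of_adj {a : ℕ} {p q : β ⊕ Fin a × η} (h : (B ⊕g copies a H).Adj p q) :
    packingPart p = packingPart q := by
  rcases p with p | p <;> rcases q with q | q
  · rfl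
  · simp at h
  · simp at h
  · exact congrArg some (sum_adj_inr.mp h).1

lemma exists_copy_or_isContained_of_connected (hG : G.Connected) {a : ℕ}
    (f : Copy G (B ⊕g copies a H)) :
    (∃ g : Copy G B, ∀ v, f v = Sum.inl (g v)) ∨ G ⊑ H := by
  have hconst (u v : V) : packingPart (f u) = packingPart (f v) := by
    obtain ⟨w⟩ := hG.preconnected u v
    induction w with
    | nil => rfl
    | cons h _ ih => exact (packingPart_eq_of_adj (f.toHom.map_adj h)).trans ih
  obtain ⟨v₀⟩ := hG.nonempty
  rcases hv₀ : f v₀ with b₀ | ⟨i, h₀⟩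
  · left
    have hl (v : V) : ∃ b, f v = Sum.inl b := by
      have := hconst v v₀
      rcases hv : f v with b | p
      · exact ⟨b, rfl⟩
      · simp [hv, hv₀, packingPart] at this
    choose g hg using hl
    refine ⟨⟨⟨g, fun {u v} huv => ?_⟩, fun u v huv => f.injective ?_⟩, hg⟩
    · have := f.toHom.map_adj huv
      rwa [Copy.toHom_apply, Copy.toHom_apply, hg, hg, sum_adj_inl] at this
    · exact (hg u).trans ((congrArg Sum.inl huv).trans (hg v).symm)
  · right
    have hr (v : V) : ∃ b, f v = Sum.inr (i, b) := by
      have := hconst v v₀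
      rcases hv : f v with b | ⟨j, b⟩
      · simp [hv, hv₀, packingPart] at this
      · obtain rfl : j = i := by simpa [hv, hv₀, packingPart] using this
        exact ⟨b, rfl⟩
    choose g hg using hr
    refine ⟨⟨⟨g, fun {u v} huv => ?_⟩, fun u v huv => f.injective ?_⟩⟩
    · have := f.toHom.map_adj huv
      rw [Copy.toHom_apply, Copy.toHom_apply, hg, hg, sum_adj_inr] at this
      exact this.2
    · exact (hg u).trans ((congrArg (fun b => Sum.inr (i, b)) huv).trans (hg v).symm)

lemma isContained_of_connectedComponent {W : Type} {K : SimpleGraph W}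
    (f : ∀ C : G.ConnectedComponent, Copy C.toSimpleGraph K)
    (hf : ∀ C D u v, f C u = f D v → C = D) : G ⊑ K := by
  have hcongr {v : V} {C : G.ConnectedComponent} (h : G.connectedComponentMk v = C) :
      f (G.connectedComponentMk v) ⟨v, rfl⟩ = f C ⟨v, h⟩ := by
    subst h
    rfl
  refine ⟨⟨⟨fun v => f (G.connectedComponentMk v) ⟨v, rfl⟩, fun {u v} huv => ?_⟩,
    fun u v huv => ?_⟩⟩
  · rw [hcongr (ConnectedComponent.connectedComponentMk_eq_of_adj huv)]
    exact (f (G.connectedComponentMk v)).toHom.map_adj huv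
  · change f _ _ = f _ _ at huv
    rw [hcongr (hf _ _ _ _ huv)] at huv
    exact congrArg Subtype.val ((f _).injective huv)

lemma isContained_packing_of_connectedComponent [Finite V] [Nonempty V]
    (hB : ∀ C : G.ConnectedComponent, C.toSimpleGraph ⊑ B)
    (hH : ∀ C D : G.ConnectedComponent, C ≠ D → C.toSimpleGraph ⊑ H ∨ D.toSimpleGraph ⊑ H) :
    G ⊑ B ⊕g copies (Nat.card G.ConnectedComponent - 1) H := by
  classical
  have := Fintype.ofFinite G.ConnectedComponent
  obtain ⟨C₀, hC₀⟩ : ∃ C₀ : G.ConnectedComponent, ∀ C ≠ C₀, C.toSimpleGraph ⊑ H := by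
    by_cases h : ∀ C : G.ConnectedComponent, C.toSimpleGraph ⊑ H
    · exact ⟨G.connectedComponentMk (Classical.arbitrary V), fun C _ => h C⟩
    · obtain ⟨C₀, hC₀⟩ := not_forall.mp h
      exact ⟨C₀, fun C hC => (hH C C₀ hC).resolve_right hC₀⟩
  let e : {C // C ≠ C₀} ≃ Fin (Nat.card G.ConnectedComponent - 1) :=
    Fintype.equivFinOfCardEq (by simp)
  let part : G.ConnectedComponent ≃ Option (Fin (Nat.card G.ConnectedComponent - 1)) :=
    (Equiv.optionSubtypeNe C₀).symm.trans (Equiv.optionCongr e)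
  have hcopy (C : G.ConnectedComponent) :
      ∃ f : Copy C.toSimpleGraph (B ⊕g copies (Nat.card G.ConnectedComponent - 1) H),
        ∀ v, packingPart (f v) = part C := by
    by_cases hC : C = C₀
    · obtain ⟨f⟩ := hB C
      exact ⟨Embedding.sumInl.toCopy.comp f, fun v => by simp [packingPart, part, hC]⟩
    · obtain ⟨f⟩ := hC₀ C hC
      have hpart : part C = some (e ⟨C, hC⟩) := by simp [part, hC]
      refine ⟨⟨⟨fun v => Sum.inr (e ⟨C, hC⟩, f v), fun h => ?_⟩, fun u v huv => ?_⟩,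
        fun _ => hpart.symm⟩
      · exact sum_adj_inr.mpr ⟨rfl, f.toHom.map_adj h⟩
      · exact f.injective (Prod.ext_iff.mp (Sum.inr_injective huv)).2
  choose f hf using hcopy
  refine isContained_of_connectedComponent f fun C D u v huv => part.injective ?_
  rw [← hf C u, huv, hf D v]

lemma exists_connected_subset_card_eq {T : Finset V} (hT : (G.induce (T : Set V)).Connected) {k : ℕ}
    (hk : 0 < k) (hkT : k ≤ T.card) :
    ∃ T' ⊆ T, T'.card = k ∧ (G.induce (T' : Set V)).Connected := by
  classical
  obtain ⟨m, hm⟩ := Nat.exists_eq_add_of_le hkT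
  induction m generalizing T with
  | zero => exact ⟨T, subset_rfl, hm, hT⟩
  | succ m ih =>
    have : Nontrivial (T : Set V) := by
      rw [Set.nontrivial_coe_sort, Finset.nontrivial_coe, ← Finset.one_lt_card_iff_nontrivial]
      omega
    obtain ⟨v, hv⟩ := hT.exists_connected_induce_compl_singleton_of_finite_nontrivial
    have hcard : (T.erase v).card = T.card - 1 := Finset.card_erase_of_mem v.2
    let g : (G.induce (T : Set V)).induce {v}ᶜ →g G.induce ((T.erase v : Finset V) : Set V) :=
      ⟨fun a => ⟨a.1.1, Finset.mem_coe.mpr (Finset.mem_erase.mpr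
        ⟨fun h => a.2 (Subtype.ext h), a.1.2⟩)⟩, fun {a b} hab => hab⟩
    have hcon : (G.induce ((T.erase v : Finset V) : Set V)).Connected := by
      refine hv.map g ?_
      rintro ⟨a, ha⟩
      have ha' := Finset.mem_erase.mp (Finset.mem_coe.mp ha)
      exact ⟨⟨⟨a, ha'.2⟩, fun h => ha'.1 (congrArg Subtype.val h)⟩, rfl⟩
    obtain ⟨T', hT', h⟩ := ih hcon (by omega) (by omega)
    exact ⟨T', hT'.trans (Finset.erase_subset _ _), h⟩

lemma card_le_of_induce_isContained [Finite η] {T : Finset V} (h : G.induce (T : Set V) ⊑ H) :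
    T.card ≤ Nat.card η := by
  obtain ⟨f⟩ := h
  simpa using Nat.card_le_card_of_injective f f.injective

lemma exists_connected_subset_not_isContained [Finite η] {T : Finset V}
    (hT : (G.induce (T : Set V)).Connected) (hTH : ¬ G.induce (T : Set V) ⊑ H) :
    ∃ T' ⊆ T, T'.card ≤ Nat.card η + 1 ∧ (G.induce (T' : Set V)).Connected ∧
      ¬ G.induce (T' : Set V) ⊑ H := by
  rcases le_total T.card (Nat.card η + 1) with hle | hle
  · exact ⟨T, subset_rfl, hle, hT, hTH⟩
  · obtain ⟨T', hT'T, hcard, hT'⟩ := exists_connected_subset_card_eq hT (Nat.succ_pos _) hle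
    exact ⟨T', hT'T, hcard.le, hT', fun h => by
      have := card_le_of_induce_isContained h
      omega⟩

/-- Conditions on `B` and `H` under which a graph is a subgraph of some `B ⊕g copies a H` as soon as
its small induced subgraphs are. -/
structure IsPackingPair (B : SimpleGraph β) (H : SimpleGraph η) : Prop where
  isContained : H ⊑ B
  card_lt : Nat.card β < 2 * (Nat.card η + 1)
  induce_isContained : ∀ T : Finset β, T.card ≤ Nat.card η → B.induce (T : Set β) ⊑ H

namespace IsPackingPair

lemma isContained_of_isSubPacking (h : IsPackingPair B H) (hG : G.Connected)
    (hp : IsSubPacking B H G) : G ⊑ B := by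
  obtain ⟨a, ⟨f⟩⟩ := hp
  rcases exists_copy_or_isContained_of_connected hG f with ⟨g, -⟩ | hH
  · exact ⟨g⟩
  · exact hH.trans h.isContained

lemma isContained_of_locally_isSubPacking [Finite β] (h : IsPackingPair B H)
    (hG : ∀ T : Finset V, T.card ≤ 2 * (Nat.card η + 1) → IsSubPacking B H (G.induce (T : Set V)))
    {T : Finset V} (hT : (G.induce (T : Set V)).Connected) : G.induce (T : Set V) ⊑ B := by
  have hcard := h.card_lt
  by_contra hTB
  obtain ⟨T', -, hle, hT', hT'B⟩ := exists_connected_subset_not_isContained hT hTB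
  exact hT'B (h.isContained_of_isSubPacking hT' (hG T' (by omega)))

lemma isContained_of_card_le [Finite V] (h : IsPackingPair B H) (hcard : Nat.card V ≤ Nat.card η)
    (hG : G ⊑ B) : G ⊑ H := by
  classical
  have := Fintype.ofFinite V
  obtain ⟨f⟩ := hG
  refine IsContained.trans ⟨copyCodRestrict f ((Finset.univ.image f : Finset β) : Set β) ?_⟩
    (h.induce_isContained _ (Finset.card_image_le.trans ?_))
  · simp
  · rwa [Finset.card_univ, ← Nat.card_eq_fintype_card]

/-- Two disjoint connected sets which do not fit into copies of `H` have to be placed side by side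
in `B`, where there is no room for both. -/
lemma isContained_or_of_disjoint [Finite β] [Finite η] (h : IsPackingPair B H)
    (hG : ∀ T : Finset V, T.card ≤ 2 * (Nat.card η + 1) → IsSubPacking B H (G.induce (T : Set V)))
    {S T : Finset V} (hS : (G.induce (S : Set V)).Connected)
    (hT : (G.induce (T : Set V)).Connected) (hST : Disjoint S T) :
    G.induce (S : Set V) ⊑ H ∨ G.induce (T : Set V) ⊑ H := by
  classical
  by_contra hc
  rw [not_or] at hc
  obtain ⟨S', hS'S, hScard, hS', hS'H⟩ := exists_connected_subset_not_isContained hS hc.1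
  obtain ⟨T', hT'T, hTcard, hT', hT'H⟩ := exists_connected_subset_not_isContained hT hc.2
  have hdisj : Disjoint S' T' := hST.mono hS'S hT'T
  obtain ⟨a, ⟨f⟩⟩ := hG (S' ∪ T') (by rw [Finset.card_union_of_disjoint hdisj]; omega)
  have hplace {U : Finset V} (hU : (G.induce (U : Set V)).Connected)
      (hUH : ¬ G.induce (U : Set V) ⊑ H) (hsub : (U : Set V) ⊆ ↑(S' ∪ T')) :
      ∃ g : Copy (G.induce (U : Set V)) B, ∀ u, f (Set.inclusion hsub u) = Sum.inl (g u) :=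
    (exists_copy_or_isContained_of_connected hU
      (f.comp (induceHomOfLE G hsub).toCopy)).resolve_right hUH
  have hlarge {U : Finset V} (g : Copy (G.induce (U : Set V)) B)
      (hUH : ¬ G.induce (U : Set V) ⊑ H) : Nat.card η + 1 ≤ U.card := by
    by_contra! hU
    exact hUH (h.isContained_of_card_le (by simpa using Nat.le_of_lt_succ hU) ⟨g⟩)
  obtain ⟨g, hg⟩ := hplace hS' hS'H (Finset.coe_subset.mpr Finset.subset_union_left)
  obtain ⟨k, hk⟩ := hplace hT' hT'H (Finset.coe_subset.mpr Finset.subset_union_right)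
  have hinj : Function.Injective (Sum.elim g k) := by
    refine g.injective.sumElim k.injective fun u v huv => ?_
    have hfuv := f.injective ((hg u).trans ((congrArg Sum.inl huv).trans (hk v).symm))
    have huv' : u.1 = v.1 := congrArg Subtype.val hfuv
    exact Finset.disjoint_left.mp hdisj u.2 (huv' ▸ v.2)
  have hroom : S'.card + T'.card ≤ Nat.card β := by
    simpa using Nat.card_le_card_of_injective _ hinj
  have := hlarge g hS'H
  have := hlarge k hT'H
  have := h.card_lt
  omega

lemma isContained_of_locally [Finite β] [Finite η] [Finite V] [Nonempty V] (h : IsPackingPair B H)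
    (hG : ∀ T : Finset V, T.card ≤ 2 * (Nat.card η + 1) → IsSubPacking B H (G.induce (T : Set V))) :
    G ⊑ B ⊕g copies (Nat.card G.ConnectedComponent - 1) H := by
  have hsupp (C : G.ConnectedComponent) : ∃ T : Finset V, (T : Set V) = C.supp :=
    ⟨C.supp.toFinite.toFinset, by simp⟩
  choose T hT using hsupp
  have hcon (C : G.ConnectedComponent) : (G.induce (T C : Set V)).Connected := by
    rw [hT]
    exact C.connected_toSimpleGraph
  refine isContained_packing_of_connectedComponent (fun C => ?_) fun C D hCD => ?_
  · have := h.isContained_of_locally_isSubPacking hG (hcon C)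
    rwa [hT] at this
  · have := h.isContained_or_of_disjoint hG (hcon C) (hcon D) (by
      rw [← Finset.disjoint_coe, hT, hT]
      exact pairwise_disjoint_supp_connectedComponent G hCD)
    rwa [hT, hT] at this

lemma isLocal [Finite β] [Finite η] (h : IsPackingPair B H) :
    IsLocal (IsSubPacking B H) (2 * (Nat.card η + 1)) := by
  intro V _ G hG
  cases isEmpty_or_nonempty V
  · exact ⟨0, IsContained.of_isEmpty⟩
  · exact ⟨_, h.isContained_of_locally hG⟩

lemma isContained_packing [Finite β] [Finite η] [Finite V] [Nonempty V] (h : IsPackingPair B H)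
    (hG : IsSubPacking B H G) : G ⊑ B ⊕g copies (Nat.card G.ConnectedComponent - 1) H :=
  h.isContained_of_locally fun _ _ => isMonotone_isSubPacking ⟨Copy.induce G _⟩ hG

end IsPackingPair

end SubPackings

section PackingEdges

variable {β η V : Type} {B : SimpleGraph β} {H : SimpleGraph η} {G : SimpleGraph V}

lemma packing_isContained_packing {a b : ℕ} (hab : a ≤ b) :
    B ⊕g copies a H ⊑ B ⊕g copies b H := by
  let f : copies a H ↪g copies b H :=
    ⟨⟨Prod.map (Fin.castLE hab) id, (Fin.castLE_injective hab).prodMap Function.injective_id⟩,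
      by simp⟩
  exact (Embedding.sum Embedding.refl f).isContained

lemma card_packing [Finite β] [Finite η] (a : ℕ) :
    Nat.card (β ⊕ Fin a × η) = Nat.card β + a * Nat.card η := by
  simp

lemma numEdges_packing [Finite β] [Finite η] (a : ℕ) :
    numEdges (B ⊕g copies a H) = numEdges B + a * numEdges H := by
  rw [numEdges_sum, numEdges_copies]

namespace IsPackingPair

lemma connectedComponent_isContained (h : IsPackingPair B H) (hG : IsSubPacking B H G)
    (C : G.ConnectedComponent) : C.toSimpleGraph ⊑ B :=
  h.isContained_of_isSubPacking C.connected_toSimpleGraph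
    (isMonotone_isSubPacking ⟨Copy.induce G C.supp⟩ hG)

lemma exists_isContained_and_numEdges_add_le [Finite β] [Finite η] [Finite V] [Nonempty V]
    (h : IsPackingPair B H) (hB : B.IsAcyclic) (hG : IsSubPacking B H G) :
    ∃ a, G ⊑ B ⊕g copies a H ∧ numEdges G + (a + 1) ≤ Nat.card V := by
  have hpos : 0 < Nat.card G.ConnectedComponent := Nat.card_pos
  refine ⟨_, h.isContained_packing hG, ?_⟩
  rw [Nat.sub_add_cancel hpos]
  refine numEdges_add_card_connectedComponent_le fun C => ?_
  obtain ⟨f⟩ := h.connectedComponent_isContained hG C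
  exact ⟨C.connected_toSimpleGraph, hB.comap f.toHom f.injective⟩

lemma succ_mul_numEdges_le [Finite β] [Finite η] [Finite V] [Nonempty V]
    (h : IsPackingPair B H) (hB : B.IsAcyclic) (hG : IsSubPacking B H G) :
    (numEdges H + 1) * numEdges G + numEdges H ≤ numEdges H * Nat.card V + numEdges B := by
  obtain ⟨a, hGa, ha⟩ := h.exists_isContained_and_numEdges_add_le hB hG
  have hedges : numEdges G ≤ numEdges B + a * numEdges H :=
    (numEdges_le_of_isContained hGa).trans_eq (numEdges_packing a)
  calc (numEdges H + 1) * numEdges G + numEdges H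
      ≤ numEdges H * (numEdges G + 1) + (numEdges B + a * numEdges H) := by linarith
    _ = numEdges H * (numEdges G + (a + 1)) + numEdges B := by ring
    _ ≤ numEdges H * Nat.card V + numEdges B := by gcongr

lemma nonempty_iso [Finite β] [Finite η] [Finite V] [Nonempty V] (h : IsPackingPair B H)
    (hB : B.IsTree) (hH : H.IsTree) (hG : IsSubPacking B H G) {a : ℕ}
    (hV : Nat.card V = Nat.card (β ⊕ Fin a × η))
    (hle : numEdges (B ⊕g copies a H) ≤ numEdges G) : Nonempty (G ≃g B ⊕g copies a H) := by
  obtain ⟨b, hGb, hb⟩ := h.exists_isContained_and_numEdges_add_le hB.isAcyclic hG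
  refine nonempty_iso_of_isContained (hGb.trans (packing_isContained_packing ?_)) hV hle
  have hBe := numEdges_add_one_of_isTree hB
  have hHe := numEdges_add_one_of_isTree hH
  rw [numEdges_packing] at hle
  rw [card_packing, ← hBe, ← hHe] at hV
  linarith

end IsPackingPair

lemma exists_isContained_isContained {W : Type} {L : SimpleGraph V} {M : SimpleGraph W} [Finite W]
    {m : ℕ} (h : L ⊑ M) (hL : Nat.card V ≤ m) (hM : m ≤ Nat.card W) :
    ∃ X : SimpleGraph (Fin m), L ⊑ X ∧ X ⊑ M := by
  classical
  obtain ⟨f⟩ := h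
  have := Fintype.ofFinite W
  have := Fintype.ofInjective f f.injective
  rw [Nat.card_eq_fintype_card] at hL hM
  obtain ⟨T, hfT, rfl⟩ := Finset.exists_superset_card_eq (s := Finset.univ.image f)
    (Finset.card_image_le.trans hL) hM
  let e : (M.induce (T : Set W)).comap T.equivFin.symm ≃g M.induce (T : Set W) := Iso.comap _ _
  exact ⟨_, IsContained.trans ⟨copyCodRestrict f _ fun v => hfT (by simp)⟩ e.isContained',
    e.isContained.trans ⟨Copy.induce M _⟩⟩

end PackingEdges

section PathsAndStars

lemma isTree_pathGraph_succ (k : ℕ) : (pathGraph (k + 1)).IsTree := by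
  refine isTree_iff_connected_and_card.mpr ⟨pathGraph_connected k, le_antisymm ?_
    (pathGraph_connected k).card_vert_le_card_edgeSet_add_one⟩
  have hsub : (pathGraph (k + 1)).edgeSet ⊆
      Set.range fun i : Fin k => s(i.castSucc, i.succ) := by
    intro e
    induction e with
    | h u v =>
      intro h
      rw [mem_edgeSet, pathGraph_adj] at h
      rcases h with h | h
      · exact ⟨⟨u, by omega⟩, by rw [Sym2.eq_iff]; left; constructor <;> ext <;> simp [h]⟩
      · exact ⟨⟨v, by omega⟩, by rw [Sym2.eq_iff]; right; constructor <;> ext <;> simp [h]⟩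
  simpa using (Set.ncard_le_ncard hsub (Set.finite_range _)).trans (Finite.card_range_le _)

lemma pathGraph_isContained_pathGraph {k n : ℕ} (hkn : k ≤ n) : pathGraph k ⊑ pathGraph n :=
  ⟨⟨⟨Fin.castLE hkn, fun h => by simpa [pathGraph_adj] using h⟩, Fin.castLE_injective hkn⟩⟩

lemma induce_pathGraph_isContained {n : ℕ} (T : Finset (Fin n)) :
    (pathGraph n).induce (T : Set (Fin n)) ⊑ pathGraph T.card := by
  let r : Fin T.card ≃o T := T.orderIsoOfFin rfl
  have hcov {x y : T} (h : x.1 ⋖ y.1) : r.symm x ⋖ r.symm y :=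
    (apply_covBy_apply_iff r.symm).mpr (CovBy.of_image (OrderEmbedding.subtype (· ∈ T)) h)
  exact ⟨⟨⟨r.symm, Or.imp hcov hcov⟩, r.symm.injective⟩⟩

lemma isPackingPair_pathGraph {k n : ℕ} (hkn : k ≤ n) (hn : n < 2 * (k + 1)) :
    IsPackingPair (pathGraph n) (pathGraph k) where
  isContained := pathGraph_isContained_pathGraph hkn
  card_lt := by simpa using hn
  induce_isContained T hT := (induce_pathGraph_isContained T).trans
    (pathGraph_isContained_pathGraph (by simpa using hT))

lemma isPackingPair_self {η : Type} (H : SimpleGraph η) : IsPackingPair H H where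
  isContained := IsContained.refl H
  card_lt := by omega
  induce_isContained T _ := ⟨Copy.induce H T⟩

end PathsAndStars

section Admissible

variable {V : Type} {G : SimpleGraph V}

lemma numEdges_pathGraph_succ (k : ℕ) : numEdges (pathGraph (k + 1)) = k := by
  simpa using numEdges_add_one_of_isTree (isTree_pathGraph_succ k)

lemma numEdges_starGraph [Finite V] (v : V) : numEdges (starGraph v) + 1 = Nat.card V :=
  numEdges_add_one_of_isTree (isTree_starGraph v)

/-- The graphs `X` for which `K_2 + X` is to be allowed: the subgraphs of some `P_8 ∪ a · P_4` and
those of some `b · K_{1,3}`. -/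
def Admissible : GraphProperty := fun _ G =>
  IsSubPacking (pathGraph 8) (pathGraph 4) G ∨
    IsSubPacking (starGraph (0 : Fin 4)) (starGraph (0 : Fin 4)) G

lemma isMonotone_admissible : IsMonotone Admissible :=
  isMonotone_isSubPacking.or isMonotone_isSubPacking

lemma isPackingPair_pathGraph_eight_four : IsPackingPair (pathGraph 8) (pathGraph 4) :=
  isPackingPair_pathGraph (by norm_num) (by norm_num)

lemma isLocal_admissible : IsLocal Admissible 20 := by
  have hlocal := isPackingPair_pathGraph_eight_four.isLocal.or
    (isPackingPair_self (starGraph (0 : Fin 4))).isLocal isMonotone_isSubPacking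
    isMonotone_isSubPacking
  rwa [Nat.card_fin] at hlocal

lemma admissible_copies_starGraph (b : ℕ) : Admissible (copies b (starGraph (0 : Fin 4))) :=
  Or.inr ⟨b, Embedding.sumInr.isContained⟩

lemma four_mul_numEdges_le_of_isSubPacking_pathGraph [Finite V] [Nonempty V]
    (h : IsSubPacking (pathGraph 8) (pathGraph 4) G) :
    4 * numEdges G ≤ 3 * Nat.card V + 4 := by
  have := isPackingPair_pathGraph_eight_four.succ_mul_numEdges_le
    (isTree_pathGraph_succ 7).isAcyclic h
  rw [numEdges_pathGraph_succ 7, numEdges_pathGraph_succ 3] at this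
  omega

lemma four_mul_numEdges_le_of_isSubPacking_starGraph [Finite V] [Nonempty V]
    (h : IsSubPacking (starGraph (0 : Fin 4)) (starGraph (0 : Fin 4)) G) :
    4 * numEdges G ≤ 3 * Nat.card V := by
  have := (isPackingPair_self _).succ_mul_numEdges_le (isAcyclic_starGraph 0) h
  have hstar := numEdges_starGraph (0 : Fin 4)
  rw [Nat.card_fin] at hstar
  rw [Nat.succ_injective hstar] at this
  omega

namespace Admissible

lemma four_mul_numEdges_le [Finite V] [Nonempty V] (h : Admissible G) :
    4 * numEdges G ≤ 3 * Nat.card V + 4 := by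
  rcases h with h | h
  · exact four_mul_numEdges_le_of_isSubPacking_pathGraph h
  · exact (four_mul_numEdges_le_of_isSubPacking_starGraph h).trans (Nat.le_add_right _ _)

lemma nonempty_iso [Finite V] (h : Admissible G) {a : ℕ} (hV : Nat.card V = 8 + 4 * a)
    (he : 7 + 3 * a ≤ numEdges G) : Nonempty (G ≃g pathGraph 8 ⊕g copies a (pathGraph 4)) := by
  have : Nonempty V := (Nat.card_pos_iff.mp (by omega)).1
  rcases h with h | h
  · refine isPackingPair_pathGraph_eight_four.nonempty_iso (isTree_pathGraph_succ 7)
      (isTree_pathGraph_succ 3) h ?_ ?_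
    · rw [hV, card_packing, Nat.card_fin, Nat.card_fin, mul_comm]
    · rwa [numEdges_packing, numEdges_pathGraph_succ 7, numEdges_pathGraph_succ 3, mul_comm]
  · have := four_mul_numEdges_le_of_isSubPacking_starGraph h
    omega

end Admissible

lemma exists_admissible_le_numEdges {m : ℕ} (hm : 8 ≤ m) :
    ∃ X : SimpleGraph (Fin m), Admissible X ∧ 3 * (m / 4) + 1 ≤ numEdges X := by
  obtain ⟨a, ha⟩ : ∃ a, m / 4 = a + 2 := ⟨m / 4 - 2, by omega⟩
  obtain ⟨X, haX, hXa⟩ := exists_isContained_isContained (m := m)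
    (packing_isContained_packing (B := pathGraph 8) (H := pathGraph 4) a.le_succ)
    (by rw [card_packing, Nat.card_fin, Nat.card_fin]; omega)
    (by rw [card_packing, Nat.card_fin, Nat.card_fin]; omega)
  refine ⟨X, Or.inl ⟨_, hXa⟩, le_trans ?_ (numEdges_le_of_isContained haX)⟩
  rw [numEdges_packing, numEdges_pathGraph_succ 7, numEdges_pathGraph_succ 3]
  omega

end Admissible

section Extremal

variable {𝓕 : GraphFamily} {P : GraphProperty} {k n : ℕ} {V : Type} {H : SimpleGraph V}
  {G : SimpleGraph (Fin n)}

lemma FamilyFree.of_isContained {W : Type} {K : SimpleGraph W} (hK : FamilyFree 𝓕 K) (h : H ⊑ K) :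
    FamilyFree 𝓕 H :=
  fun F hF hFH => hK F hF (hFH.trans h)

lemma exists_iso_fin [Finite V] (hV : Nat.card V = n) (H : SimpleGraph V) :
    ∃ G : SimpleGraph (Fin n), Nonempty (G ≃g H) :=
  ⟨H.comap (Finite.equivFinOfCardEq hV).symm, ⟨Iso.comap _ H⟩⟩

lemma exists_familyFree_forall_le {α : Type*} [LinearOrder α] (f : SimpleGraph (Fin n) → α)
    (hG : FamilyFree 𝓕 G) :
    ∃ G₀, FamilyFree 𝓕 G₀ ∧ ∀ G' : SimpleGraph (Fin n), FamilyFree 𝓕 G' → f G' ≤ f G₀ :=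
  Set.exists_max_image {G : SimpleGraph (Fin n) | FamilyFree 𝓕 G} f (Set.toFinite _) ⟨G, hG⟩

lemma numEdges_le_of_mem_EX [Finite V] (hG : G ∈ EX n 𝓕) (hH : FamilyFree 𝓕 H)
    (hV : Nat.card V = n) : numEdges H ≤ numEdges G := by
  obtain ⟨G', ⟨e⟩⟩ := exists_iso_fin hV H
  rw [← numEdges_eq_of_iso e]
  exact hG.2 G' (hH.of_isContained e.isContained)

lemma mem_EX_of_iso {G' : SimpleGraph (Fin n)} (hG : G ∈ EX n 𝓕) (e : G' ≃g G) : G' ∈ EX n 𝓕 := by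
  refine ⟨hG.1.of_isContained e.isContained, fun K hK => ?_⟩
  rw [numEdges_eq_of_iso e]
  exact hG.2 K hK

lemma card_fin_sum_fin_sub (hk : k ≤ n) : Nat.card (Fin k ⊕ Fin (n - k)) = n := by
  simpa using Nat.add_sub_of_le hk

namespace IsObstructionFamily

variable (h𝓕 : IsObstructionFamily 𝓕 (Apex k P)) (hP : IsMonotone P)
include h𝓕 hP

lemma familyFree_join [Finite V] (hH : P H) : FamilyFree 𝓕 (join (completeGraph (Fin k)) H) :=
  (h𝓕 _).mpr (by simpa using apex_join (G := completeGraph (Fin k)) hP hH)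

lemma exists_join_of_familyFree (hk : k ≤ n) (hG : FamilyFree 𝓕 G) :
    ∃ X : SimpleGraph (Fin (n - k)), P X ∧ G ⊑ join (completeGraph (Fin k)) X := by
  have hG' := (h𝓕 G).mp hG
  have := exists_join_of_apex hP (by rwa [Nat.card_fin]) hG'
  rwa [Nat.card_fin] at this

lemma exists_iso_join_of_mem_EX (hk : k ≤ n) (hG : G ∈ EX n 𝓕) :
    ∃ X : SimpleGraph (Fin (n - k)), Nonempty (G ≃g join (completeGraph (Fin k)) X) ∧ P X ∧
      ∀ Y : SimpleGraph (Fin (n - k)), P Y → numEdges Y ≤ numEdges X := by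
  have hcard := card_fin_sum_fin_sub hk
  obtain ⟨X, hX, hGX⟩ := h𝓕.exists_join_of_familyFree hP hk hG.1
  have hle := numEdges_le_of_mem_EX hG (h𝓕.familyFree_join hP hX) hcard
  obtain ⟨e⟩ := nonempty_iso_of_isContained hGX (by rw [hcard, Nat.card_fin]) hle
  refine ⟨X, ⟨e⟩, hX, fun Y hY => ?_⟩
  have hYle := numEdges_le_of_mem_EX hG (h𝓕.familyFree_join hP hY) hcard
  rw [numEdges_eq_of_iso e, numEdges_join, numEdges_join] at hYle
  omega

end IsObstructionFamily

end Extremal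

section AdmissibleExtremal

variable {V : Type} {𝓕 : GraphFamily} {n : ℕ}

/-- Isomorphic graphs have isomorphic joins with a fixed graph. -/
def joinCongr {W W' : Type} (G : SimpleGraph V) {H : SimpleGraph W} {H' : SimpleGraph W'}
    (e : H ≃g H') : join G H ≃g join G H' where
  toEquiv := Equiv.sumCongr (Equiv.refl V) e.toEquiv
  map_rel_iff' := by rintro (a | a) (b | b) <;> simp [Iso.map_adj_iff]

lemma numEdges_completeGraph [Finite V] :
    numEdges (completeGraph V) = (Nat.card V).choose 2 := by
  classical
  have := Fintype.ofFinite V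
  rw [numEdges, ← coe_edgeFinset, Set.ncard_coe_finset, Nat.card_eq_fintype_card]
  exact card_edgeFinset_top_eq_card_choose_two

lemma four_mul_numEdges_add_le_of_apex [Finite V] {G : SimpleGraph V} (hV : 3 ≤ Nat.card V)
    (hG : Apex 2 Admissible G) : 4 * numEdges G + 14 ≤ 11 * Nat.card V := by
  obtain ⟨X, hX, hGX⟩ := exists_join_of_apex isMonotone_admissible (by omega) hG
  have : Nonempty (Fin (Nat.card V - 2)) := ⟨⟨0, by omega⟩⟩
  have hle := numEdges_le_of_isContained hGX
  have hXle := hX.four_mul_numEdges_le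
  rw [numEdges_join, numEdges_completeGraph, Nat.card_fin, Nat.card_fin, Nat.choose_self] at hle
  rw [Nat.card_fin] at hXle
  omega

namespace IsObstructionFamily

variable (h𝓕 : IsObstructionFamily 𝓕 (Apex 2 Admissible))
include h𝓕

lemma exists_familyFree (hn : 10 ≤ n) : ∃ G : SimpleGraph (Fin n), FamilyFree 𝓕 G := by
  obtain ⟨X, hX, -⟩ := exists_admissible_le_numEdges (m := n - 2) (by omega)
  obtain ⟨G, ⟨e⟩⟩ := exists_iso_fin (card_fin_sum_fin_sub (by omega)) (join (completeGraph _) X)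
  exact ⟨G, (h𝓕.familyFree_join isMonotone_admissible hX).of_isContained e.isContained⟩

lemma nonempty_EX (hn : 10 ≤ n) : (EX n 𝓕).Nonempty :=
  (h𝓕.exists_familyFree hn).elim fun _ => exists_familyFree_forall_le numEdges

lemma nonempty_SPEX (hn : 10 ≤ n) : (SPEX n 𝓕).Nonempty :=
  (h𝓕.exists_familyFree hn).elim fun _ => exists_familyFree_forall_le lam

lemma exists_admissible_of_mem_EX (hn : 10 ≤ n) {G : SimpleGraph (Fin n)} (hG : G ∈ EX n 𝓕) :
    ∃ X : SimpleGraph (Fin (n - 2)), Nonempty (G ≃g join (completeGraph (Fin 2)) X) ∧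
      Admissible X ∧ 3 * ((n - 2) / 4) + 1 ≤ numEdges X ∧ 4 * numEdges X ≤ 3 * (n - 2) + 4 := by
  have : Nonempty (Fin (n - 2)) := ⟨⟨0, by omega⟩⟩
  obtain ⟨X, e, hX, hmax⟩ := h𝓕.exists_iso_join_of_mem_EX isMonotone_admissible (by omega) hG
  obtain ⟨Y, hY, hle⟩ := exists_admissible_le_numEdges (m := n - 2) (by omega)
  exact ⟨X, e, hX, hle.trans (hmax Y hY), by simpa using hX.four_mul_numEdges_le⟩

lemma exists_abs_numEdges_sub_le_of_mem_EX (hn : 10 ≤ n) {G : SimpleGraph (Fin n)}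
    (hG : G ∈ EX n 𝓕) :
    ∃ X : SimpleGraph (Fin (n - 2)), Nonempty (G ≃g join (completeGraph (Fin 2)) X) ∧
      |(numEdges X : ℝ) - 3 * (n : ℝ) / 4| ≤ 3 := by
  obtain ⟨X, e, -, hlow, hup⟩ := h𝓕.exists_admissible_of_mem_EX hn hG
  have hlow' : (3 * n : ℝ) ≤ 4 * numEdges X + 12 := by
    exact_mod_cast (by omega : 3 * n ≤ 4 * numEdges X + 12)
  have hup' : (4 * numEdges X : ℝ) ≤ 3 * n := by
    exact_mod_cast (by omega : 4 * numEdges X ≤ 3 * n)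
  exact ⟨X, e, abs_le.mpr ⟨by linarith, by linarith⟩⟩

lemma mem_EX_iff_of_modEq (hn : 10 ≤ n) (hmod : n ≡ 2 [MOD 4]) {G : SimpleGraph (Fin n)} :
    G ∈ EX n 𝓕 ↔ Nonempty (G ≃g join (completeGraph (Fin 2))
      (pathGraph 8 ⊕g copies ((n - 10) / 4) (pathGraph 4))) := by
  have hmod' : n % 4 = 2 := hmod
  have hiso {G : SimpleGraph (Fin n)} (hG : G ∈ EX n 𝓕) : Nonempty (G ≃g
      join (completeGraph (Fin 2)) (pathGraph 8 ⊕g copies ((n - 10) / 4) (pathGraph 4))) := by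
    obtain ⟨X, ⟨e⟩, hX, hlow, -⟩ := h𝓕.exists_admissible_of_mem_EX hn hG
    obtain ⟨φ⟩ := hX.nonempty_iso (a := (n - 10) / 4) (by rw [Nat.card_fin]; omega) (by omega)
    exact ⟨(joinCongr _ φ).comp e⟩
  refine ⟨hiso, fun ⟨e⟩ => ?_⟩
  obtain ⟨G₀, hG₀⟩ := h𝓕.nonempty_EX hn
  obtain ⟨e₀⟩ := hiso hG₀
  exact mem_EX_of_iso hG₀ (e₀.symm.comp e)

lemma isBigO_ex : (fun n : ℕ => (ex n 𝓕 : ℝ)) =O[atTop] fun n : ℕ => (n : ℝ) := by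
  classical
  refine IsBigO.of_bound 3 ?_
  filter_upwards [eventually_ge_atTop 3] with n hn
  have hex : ex n 𝓕 ≤ 3 * n := by
    refine Finset.sup_le fun G hG => ?_
    have := four_mul_numEdges_add_le_of_apex (by rwa [Nat.card_fin])
      ((h𝓕 G).mp (Finset.mem_filter.mp hG).2)
    rw [Nat.card_fin] at this
    omega
  rw [Real.norm_natCast, Real.norm_natCast]
  exact_mod_cast hex

lemma not_familyFree_completeBipartiteGraph :
    ¬ FamilyFree 𝓕 (completeBipartiteGraph (Fin 3) ℕ) := by
  intro h
  have hsub : completeBipartiteGraph (Fin 3) (Fin 20) ⊑ completeBipartiteGraph (Fin 3) ℕ := by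
    refine ⟨⟨⟨Sum.map id Fin.val, ?_⟩, Function.injective_id.sumMap Fin.val_injective⟩⟩
    rintro (a | a) (b | b) <;> simp
  have hle := four_mul_numEdges_add_le_of_apex (by simp) ((h𝓕 _).mp (h.of_isContained hsub))
  rw [numEdges_completeBipartiteGraph, Nat.card_sum, Nat.card_fin, Nat.card_fin] at hle
  omega

lemma hasLinearJoinExtremal (hfin : 𝓕.Finite) : HasLinearJoinExtremal 𝓕 2 (3 / 4) := by
  refine ⟨hfin, h𝓕.isBigO_ex, h𝓕.not_familyFree_completeBipartiteGraph, 0, ?_⟩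
  filter_upwards [eventually_ge_atTop 10] with n hn
  obtain ⟨G, hG⟩ := h𝓕.nonempty_EX hn
  obtain ⟨X, ⟨e⟩, -, -, hup⟩ := h𝓕.exists_admissible_of_mem_EX hn hG
  have hup' : (4 * numEdges X : ℝ) ≤ 3 * n := by
    exact_mod_cast (by omega : 4 * numEdges X ≤ 3 * n)
  have hcontains : completeBipartiteGraph (Fin 2) (Fin (n - 2)) ⊑ G :=
    (IsContained.of_le le_sup_right).trans e.isContained'
  exact ⟨G, ⟨⟨hG.1, hcontains⟩, fun G' hG' _ => hG.2 G' hG'⟩, X, ⟨e⟩, by linarith⟩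

lemma mem_EX_of_mem_EXContaining (hn : 10 ≤ n) {G : SimpleGraph (Fin n)}
    (hG : G ∈ EXContaining (join (completeGraph (Fin 2)) (emptyGraph (Fin (n - 2)))) n 𝓕) :
    G ∈ EX n 𝓕 := by
  obtain ⟨G₀, hG₀⟩ := h𝓕.nonempty_EX hn
  obtain ⟨X, ⟨e⟩, -⟩ := h𝓕.exists_admissible_of_mem_EX hn hG₀
  have hle : join (completeGraph (Fin 2)) (emptyGraph (Fin (n - 2))) ≤
      join (completeGraph (Fin 2)) X := by
    rintro (a | a) (b | b) <;> simp
  have hcontains := (IsContained.of_le hle).trans e.isContained'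
  exact ⟨hG.1.1, fun G' hG' => (hG₀.2 G' hG').trans (hG.2 G₀ hG₀.1 hcontains)⟩

end IsObstructionFamily

end AdmissibleExtremal

section Spectrum

variable {V W : Type} [Fintype V] [Fintype W] {G : SimpleGraph V} {H : SimpleGraph W} {μ : ℝ}

open scoped Classical in
/-- The entry at `i` of the product of the adjacency matrix of `G` and the vector `y`: the sum of
`y` over the neighbours of `i`. -/
noncomputable def neighborSum (G : SimpleGraph V) (y : V → ℝ) (i : V) : ℝ :=
  ∑ j, if G.Adj i j then y j else 0

open scoped Classical in
lemma mem_spectrum_adjMatrix_iff :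
    μ ∈ spectrum ℝ (G.adjMatrix ℝ) ↔ ∃ y : V → ℝ, y ≠ 0 ∧ ∀ i, neighborSum G y i = μ * y i := by
  have happ (y : V → ℝ) (i : V) : Matrix.toLin' (G.adjMatrix ℝ) y i = neighborSum G y i := by
    simp [neighborSum, Matrix.mulVec, dotProduct, adjMatrix_apply]
  rw [← Matrix.spectrum_toLin', ← Module.End.hasEigenvalue_iff_mem_spectrum]
  constructor
  · intro h
    obtain ⟨y, hy⟩ := h.exists_hasEigenvector
    refine ⟨y, hy.2, fun i => ?_⟩
    rw [← happ, hy.apply_eq_smul, Pi.smul_apply, smul_eq_mul]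
  · rintro ⟨y, hy, h⟩
    refine Module.End.hasEigenvalue_of_hasEigenvector (x := y)
      ⟨Module.End.mem_eigenspace_iff.mpr (funext fun i => ?_), hy⟩
    rw [happ, h, Pi.smul_apply, smul_eq_mul]

lemma le_lam {y : V → ℝ} (hy : y ≠ 0) (h : ∀ i, neighborSum G y i = μ * y i) : μ ≤ lam G := by
  classical
  exact le_csSup (Matrix.finite_spectrum _).bddAbove (mem_spectrum_adjMatrix_iff.mpr ⟨y, hy, h⟩)

lemma neighborSum_comp_iso_symm (e : G ≃g H) (y : V → ℝ) (i : W) :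
    neighborSum H (y ∘ e.symm) i = neighborSum G y (e.symm i) := by
  classical
  exact Fintype.sum_equiv e.symm.toEquiv _ _ fun j =>
    if_congr e.symm.map_adj_iff.symm rfl rfl

open scoped Classical in
lemma spectrum_adjMatrix_subset_of_iso (e : G ≃g H) :
    spectrum ℝ (G.adjMatrix ℝ) ⊆ spectrum ℝ (H.adjMatrix ℝ) := by
  intro μ hμ
  obtain ⟨y, hy, h⟩ := mem_spectrum_adjMatrix_iff.mp hμ
  refine mem_spectrum_adjMatrix_iff.mpr ⟨y ∘ e.symm, fun h0 => hy ?_, fun i => ?_⟩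
  · exact e.symm.surjective.injective_comp_right h0
  · rw [neighborSum_comp_iso_symm, h, Function.comp_apply]

lemma lam_eq_of_iso (e : G ≃g H) : lam G = lam H := by
  classical
  have hspec := (spectrum_adjMatrix_subset_of_iso e).antisymm
    (spectrum_adjMatrix_subset_of_iso e.symm)
  unfold lam
  convert congrArg sSup hspec

lemma abs_neighborSum_le {x y : V → ℝ} (h : ∀ j, |y j| ≤ x j) (i : V) :
    |neighborSum G y i| ≤ neighborSum G x i := by
  classical
  refine (Finset.abs_sum_le_sum_abs _ _).trans (Finset.sum_le_sum fun j _ => ?_)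
  split_ifs
  · exact h j
  · exact abs_zero.le

lemma neighborSum_const_mul (t : ℝ) (x : V → ℝ) (i : V) :
    neighborSum G (fun j => t * x j) i = t * neighborSum G x i := by
  simp only [neighborSum, Finset.mul_sum, mul_ite, mul_zero]

lemma lam_le {x : V → ℝ} (hμ : 0 ≤ μ) (hx : ∀ i, 0 < x i)
    (h : ∀ i, neighborSum G x i ≤ μ * x i) : lam G ≤ μ := by
  classical
  refine Real.sSup_le (fun κ hκ => ?_) hμ
  obtain ⟨y, hy, hyκ⟩ := mem_spectrum_adjMatrix_iff.mp hκ
  obtain ⟨i₀, hi₀⟩ := Function.ne_iff.mp hy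
  obtain ⟨i, -, hi⟩ := Finset.exists_max_image Finset.univ (fun i => |y i| / x i)
    ⟨i₀, Finset.mem_univ _⟩
  set t := |y i| / x i with ht
  have hbound (j : V) : |y j| ≤ t * x j := (div_le_iff₀ (hx j)).mp (hi j (Finset.mem_univ _))
  have htpos : 0 < t := (div_pos (abs_pos.mpr hi₀) (hx i₀)).trans_le (hi i₀ (Finset.mem_univ _))
  have hyi : |y i| = t * x i := by rw [ht, div_mul_cancel₀ _ (hx i).ne']
  refine le_of_mul_le_mul_right ?_ (mul_pos htpos (hx i))
  calc κ * (t * x i) ≤ |κ| * (t * x i) := by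
        gcongr
        exacts [(mul_pos htpos (hx i)).le, le_abs_self κ]
    _ = |neighborSum G y i| := by rw [hyκ, abs_mul, hyi]
    _ ≤ t * neighborSum G x i :=
      (abs_neighborSum_le hbound i).trans_eq (neighborSum_const_mul t x i)
    _ ≤ t * (μ * x i) := by gcongr; exact h i
    _ = μ * (t * x i) := by ring

lemma neighborSum_join_inl {y : V ⊕ W → ℝ} {i : V} :
    neighborSum (join G H) y (Sum.inl i) =
      neighborSum G (y ∘ Sum.inl) i + ∑ j, y (Sum.inr j) := by
  classical
  simp [neighborSum]

lemma neighborSum_join_inr {y : V ⊕ W → ℝ} {i : W} :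
    neighborSum (join G H) y (Sum.inr i) =
      ∑ j, y (Sum.inl j) + neighborSum H (y ∘ Sum.inr) i := by
  classical
  simp [neighborSum]

lemma neighborSum_copies {a : ℕ} {y : V → ℝ} {p : Fin a × V} :
    neighborSum (copies a G) (fun q => y q.2) p = neighborSum G y p.2 := by
  classical
  simp [neighborSum, Fintype.sum_prod_type, ite_and]

lemma neighborSum_sum_inl {y : V ⊕ W → ℝ} {i : V} :
    neighborSum (G ⊕g H) y (Sum.inl i) = neighborSum G (y ∘ Sum.inl) i := by
  classical
  simp [neighborSum]

lemma neighborSum_sum_inr {y : V ⊕ W → ℝ} {i : W} :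
    neighborSum (G ⊕g H) y (Sum.inr i) = neighborSum H (y ∘ Sum.inr) i := by
  classical
  simp [neighborSum]

lemma neighborSum_completeGraph_one (i : V) :
    neighborSum (completeGraph V) 1 i = Fintype.card V - 1 := by
  classical
  have hite (j : V) : (if (completeGraph V).Adj i j then (1 : ℝ) else 0) =
      1 - if i = j then 1 else 0 := by
    simp only [completeGraph, top_adj]
    split_ifs <;> simp_all
  simp only [neighborSum, Pi.one_apply, hite]
  simp

lemma le_lam_join_completeGraph [Nonempty V] {z : W → ℝ}
    (hz : ∀ i, Fintype.card V + neighborSum H z i = μ * z i)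
    (hsum : Fintype.card V - 1 + ∑ i, z i = μ) : μ ≤ lam (join (completeGraph V) H) := by
  refine le_lam (y := Sum.elim 1 z) (fun h => ?_) ?_
  · simpa using congrFun h (Sum.inl (Classical.arbitrary V))
  · rintro (i | i)
    · rw [neighborSum_join_inl, Sum.elim_comp_inl, neighborSum_completeGraph_one]
      simpa using hsum
    · rw [neighborSum_join_inr, Sum.elim_comp_inr]
      simpa using hz i

lemma lam_join_completeGraph_le {z : W → ℝ} (hμ : 0 ≤ μ) (hpos : ∀ i, 0 < z i)
    (hz : ∀ i, Fintype.card V + neighborSum H z i ≤ μ * z i)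
    (hsum : Fintype.card V - 1 + ∑ i, z i ≤ μ) : lam (join (completeGraph V) H) ≤ μ := by
  refine lam_le (x := Sum.elim 1 z) hμ ?_ ?_
  · rintro (_ | i)
    · exact one_pos
    · exact hpos i
  · rintro (i | i)
    · rw [neighborSum_join_inl, Sum.elim_comp_inl, neighborSum_completeGraph_one]
      simpa using hsum
    · rw [neighborSum_join_inr, Sum.elim_comp_inr]
      simpa using hz i

lemma le_lam_join_copies_starGraph {b : ℕ} (hμ : 2 ≤ μ)
    (h : (μ - 1) * (μ ^ 2 - 3) = b * (8 * μ + 12)) :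
    μ ≤ lam (join (completeGraph (Fin 2)) (copies b (starGraph (0 : Fin 4)))) := by
  have hne : μ ^ 2 - 3 ≠ 0 := by nlinarith
  let c : ℝ := (2 * μ + 6) / (μ ^ 2 - 3)
  let l : ℝ := (2 * μ + 2) / (μ ^ 2 - 3)
  have hc : 2 + 3 * l = μ * c := by
    simp only [c, l]
    field_simp
    ring
  have hl : 2 + c = μ * l := by
    simp only [c, l]
    field_simp
    ring
  have hsum : 1 + b * (c + 3 * l) = μ := by
    simp only [c, l]
    field_simp
    linarith
  refine le_lam_join_completeGraph (z := fun p => ![c, l, l, l] p.2) (fun p => ?_) ?_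
  · rw [neighborSum_copies (y := ![c, l, l, l])]
    obtain ⟨_, i⟩ := p
    fin_cases i <;> simp [neighborSum, Fin.sum_univ_four] <;> linarith
  · simp only [Fintype.sum_prod_type, Fin.sum_univ_four, Finset.sum_const, Finset.card_univ,
      Fintype.card_fin, nsmul_eq_mul, Nat.cast_ofNat, Matrix.cons_val]
    linarith

lemma neighborSum_pathGraph_eight_le {w : ℝ} (hw : 0 ≤ w) (i : Fin 8) :
    neighborSum (pathGraph 8) (fun _ => w) i ≤ 2 * w := by
  fin_cases i <;> simp [neighborSum, Fin.sum_univ_eight, pathGraph_adj] <;> linarith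

lemma lam_join_paths_le_of_weights {a : ℕ} {p q w : ℝ} (hp : 0 < p) (hq : 0 < q) (hw : 0 < w)
    (hpq : 2 + q ≤ μ * p) (hqp : 2 + (p + q) ≤ μ * q) (hww : 2 + 2 * w ≤ μ * w)
    (hsum : 1 + (8 * w + a * (2 * p + 2 * q)) ≤ μ) :
    lam (join (completeGraph (Fin 2)) (pathGraph 8 ⊕g copies a (pathGraph 4))) ≤ μ := by
  have hμ : 0 ≤ μ := le_trans (by positivity) hsum
  refine lam_join_completeGraph_le (z := Sum.elim (fun _ => w) fun r => ![p, q, q, p] r.2)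
    hμ ?_ ?_ ?_
  · rintro (_ | ⟨_, i⟩)
    · exact hw
    · fin_cases i
      exacts [hp, hq, hq, hp]
  · rintro (i | ⟨_, i⟩)
    · rw [neighborSum_sum_inl, Sum.elim_comp_inl, Sum.elim_inl, Fintype.card_fin]
      have := neighborSum_pathGraph_eight_le hw.le i
      push_cast
      linarith
    · rw [neighborSum_sum_inr, Sum.elim_comp_inr, neighborSum_copies (y := ![p, q, q, p])]
      fin_cases i <;> simp [neighborSum, Fin.sum_univ_four, pathGraph_adj] <;> linarith
  · simp only [Fintype.sum_sum_type, Fintype.sum_prod_type, Fin.sum_univ_four, Finset.sum_const,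
      Finset.card_univ, Fintype.card_fin, nsmul_eq_mul, Nat.cast_ofNat, Sum.elim_inl, Sum.elim_inr,
      Matrix.cons_val]
    linarith

/-- The neighbour sum at a vertex of `K_2` in `K_2 + (P_8 ∪ a · P_4)` of the weights that are `1` on
`K_2`, solve the eigenvalue equation for `μ` on each `P_4`, and on `P_8` have the constant value
that solves it at the vertices of degree two. It bounds the largest eigenvalue of the join, with an
error that only comes from the two ends of `P_8`. -/
noncomputable def pathsWeight (a : ℕ) (μ : ℝ) : ℝ :=
  1 + a * ((8 * μ + 4) / (μ ^ 2 - μ - 1)) + 16 / (μ - 2)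

lemma lam_join_paths_le {a : ℕ} (hμ : 3 ≤ μ)
    (h : pathsWeight a μ ≤ μ) :
    lam (join (completeGraph (Fin 2)) (pathGraph 8 ⊕g copies a (pathGraph 4))) ≤ μ := by
  have hden : 0 < μ ^ 2 - μ - 1 := by nlinarith
  have hden' : 0 < μ - 2 := by linarith
  refine lam_join_paths_le_of_weights (p := 2 * μ / (μ ^ 2 - μ - 1))
    (q := (2 * μ + 2) / (μ ^ 2 - μ - 1)) (w := 2 / (μ - 2)) (by positivity) (by positivity)
    (by positivity) (le_of_eq ?_) (le_of_eq ?_) (le_of_eq ?_) (le_of_eq_of_le ?_ h)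
  · generalize hD : μ ^ 2 - μ - 1 = D at hden
    field_simp
    linarith
  · generalize hD : μ ^ 2 - μ - 1 = D at hden
    field_simp
    linarith
  · field_simp
    ring
  · rw [pathsWeight]
    ring

lemma lam_join_paths_lt {a : ℕ} (hμ : 3 < μ)
    (h : pathsWeight a μ < μ) :
    lam (join (completeGraph (Fin 2)) (pathGraph 8 ⊕g copies a (pathGraph 4))) < μ := by
  have hden : μ ^ 2 - μ - 1 ≠ 0 := by nlinarith
  have hden' : μ - 2 ≠ 0 := by linarith
  have hcont : ContinuousAt (pathsWeight a) μ := by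
    unfold pathsWeight
    fun_prop (disch := assumption)
  have hnear : ∀ᶠ ν in 𝓝 μ, 3 < ν ∧ pathsWeight a ν < ν :=
    (lt_mem_nhds hμ).and (hcont.eventually_lt continuousAt_id h)
  obtain ⟨ν, ⟨hν, hle⟩, hlt⟩ :=
    ((hnear.filter_mono nhdsWithin_le_nhds).and (self_mem_nhdsWithin (s := Set.Iio μ))).exists
  exact (lam_join_paths_le hν.le hle.le).trans_lt hlt

lemma exists_root_copies_starGraph {b : ℕ} (hb : 52 ≤ b) :
    ∃ μ : ℝ, 21 ≤ μ ∧ (μ - 1) * (μ ^ 2 - 3) = b * (8 * μ + 12) := by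
  have hb' : (52 : ℝ) ≤ b := by exact_mod_cast hb
  obtain ⟨μ, hμ, hroot⟩ : ∃ μ ∈ Set.Icc (21 : ℝ) (20 * b),
      (μ - 1) * (μ ^ 2 - 3) - b * (8 * μ + 12) = 0 := by
    refine intermediate_value_Icc (f := fun μ : ℝ => (μ - 1) * (μ ^ 2 - 3) - b * (8 * μ + 12))
      (by linarith) (by fun_prop) ⟨by linarith, ?_⟩
    have : (0 : ℝ) ≤ b ^ 2 * (b - 52) := mul_nonneg (sq_nonneg _) (by linarith)
    nlinarith
  exact ⟨μ, hμ.1, by linarith⟩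

lemma pathsWeight_lt {a : ℕ} (hμ : 21 ≤ μ)
    (hroot : (μ - 1) * (μ ^ 2 - 3) = (a + 2 : ℕ) * (8 * μ + 12)) :
    pathsWeight a μ < μ := by
  have hden : 0 < μ ^ 2 - μ - 1 := by nlinarith
  have hden' : 0 < μ - 2 := by linarith
  have hden'' : 0 < 8 * μ + 12 := by linarith
  have ha : (a : ℝ) = (μ - 1) * (μ ^ 2 - 3) / (8 * μ + 12) - 2 := by
    rw [hroot, mul_div_cancel_right₀ _ hden''.ne']
    push_cast
    ring
  have hgap : μ - pathsWeight a μ =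
      4 * μ * (μ ^ 2 - 19 * μ - 22) / ((8 * μ + 12) * (μ ^ 2 - μ - 1) * (μ - 2)) := by
    have := hden.ne'
    rw [pathsWeight, ha]
    generalize hD : μ ^ 2 - μ - 1 = D at this
    field_simp
    rw [← hD]
    ring
  have hnum : 0 < μ ^ 2 - 19 * μ - 22 := by nlinarith
  rw [← sub_pos, hgap]
  positivity

lemma lam_join_paths_lt_lam_join_stars {a : ℕ} (ha : 50 ≤ a) :
    lam (join (completeGraph (Fin 2)) (pathGraph 8 ⊕g copies a (pathGraph 4))) <
      lam (join (completeGraph (Fin 2)) (copies (a + 2) (starGraph (0 : Fin 4)))) := by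
  obtain ⟨μ, hμ, hroot⟩ := exists_root_copies_starGraph (b := a + 2) (by omega)
  exact (lam_join_paths_lt (by linarith) (pathsWeight_lt hμ hroot)).trans_le
    (le_lam_join_copies_starGraph (by linarith) hroot)

end Spectrum

namespace IsObstructionFamily

variable {𝓕 : GraphFamily} {n : ℕ} (h𝓕 : IsObstructionFamily 𝓕 (Apex 2 Admissible))
include h𝓕

lemma SPEX_inter_EX_eq_empty (hn : 210 ≤ n) (hmod : n ≡ 2 [MOD 4]) :
    SPEX n 𝓕 ∩ EX n 𝓕 = ∅ := by
  have hmod' : n % 4 = 2 := hmod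
  refine Set.eq_empty_of_forall_notMem fun G ⟨hS, hE⟩ => ?_
  obtain ⟨e⟩ := (h𝓕.mem_EX_iff_of_modEq (by omega) hmod).mp hE
  obtain ⟨G', ⟨e'⟩⟩ := exists_iso_fin (n := n) (by simp; omega) (join (completeGraph (Fin 2))
    (copies ((n - 10) / 4 + 2) (starGraph (0 : Fin 4))))
  have hG' : FamilyFree 𝓕 G' :=
    (h𝓕.familyFree_join isMonotone_admissible (admissible_copies_starGraph _)).of_isContained
      e'.isContained
  have hle := hS.2 G' hG'
  rw [lam_eq_of_iso e, lam_eq_of_iso e'] at hle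
  exact (lam_join_paths_lt_lam_join_stars (by omega)).not_ge hle

lemma infinite_setOf_SPEX_inter_EX_eq_empty :
    {n : ℕ | n ≡ 2 [MOD 4] ∧ SPEX n 𝓕 ∩ EX n 𝓕 = ∅}.Infinite := by
  refine Set.infinite_of_forall_exists_gt fun N => ?_
  have hmod : 4 * (N + 52) + 2 ≡ 2 [MOD 4] := by simp [Nat.ModEq]
  exact ⟨_, ⟨hmod, h𝓕.SPEX_inter_EX_eq_empty (by omega) hmod⟩, by omega⟩

lemma not_spexSubsetEventually : ¬ SpexSubsetEventually 𝓕 2 := by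
  intro h
  obtain ⟨N, hN⟩ := eventually_atTop.mp h
  obtain ⟨n, ⟨-, hempty⟩, hn⟩ :=
    h𝓕.infinite_setOf_SPEX_inter_EX_eq_empty.exists_gt (max N 10)
  obtain ⟨G, hG⟩ := h𝓕.nonempty_SPEX (n := n) (by omega)
  have hE := h𝓕.mem_EX_of_mem_EXContaining (by omega) (hN n (by omega) hG)
  exact Set.notMem_empty G (hempty ▸ ⟨hG, hE⟩)

end IsObstructionFamily

end TuranSpectral

theorem proposition1p2 :
    ∃ 𝓕 : TuranSpectral.GraphFamily, 𝓕.Finite ∧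
      -- For all large `n`, the extremal graphs are `K_2 + X` with `e(X) = 3n/4 + O(1)`.
      (∃ C : ℝ, ∀ᶠ n : ℕ in atTop,
        (TuranSpectral.EX n 𝓕).Nonempty ∧
        ∀ G ∈ TuranSpectral.EX n 𝓕, ∃ X : SimpleGraph (Fin (n - 2)),
          Nonempty (G ≃g TuranSpectral.join (completeGraph (Fin 2)) X) ∧
          |(TuranSpectral.numEdges X : ℝ) - 3 * (n : ℝ) / 4| ≤ C) ∧
      -- For large `n ≡ 2 (mod 4)` there is exactly one, `K_2 + (P_8 ∪ ((n - 10) / 4) · P_4)`.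
      (∀ᶠ n : ℕ in atTop, n ≡ 2 [MOD 4] →
        ∀ G : SimpleGraph (Fin n), G ∈ TuranSpectral.EX n 𝓕 ↔
          Nonempty (G ≃g TuranSpectral.join (completeGraph (Fin 2))
            (pathGraph 8 ⊕g TuranSpectral.copies ((n - 10) / 4) (pathGraph 4)))) ∧
      -- For infinitely many `n`, even among `n ≡ 2 (mod 4)`, `SPEX` and `EX` are disjoint.
      {n : ℕ | n ≡ 2 [MOD 4] ∧ TuranSpectral.SPEX n 𝓕 ∩ TuranSpectral.EX n 𝓕 = ∅}.Infinite ∧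
      -- The implication known for `Q < 3/4` fails at `Q = 3/4`.
      TuranSpectral.HasLinearJoinExtremal 𝓕 2 (3 / 4) ∧
      ¬ TuranSpectral.SpexSubsetEventually 𝓕 2 := by
  obtain ⟨𝓕, hfin, h𝓕⟩ := TuranSpectral.exists_finite_isObstructionFamily
    (TuranSpectral.isMonotone_admissible.apex (k := 2))
    (TuranSpectral.isLocal_admissible.apex TuranSpectral.isMonotone_admissible)
  refine ⟨𝓕, hfin, ⟨3, ?_⟩, ?_, h𝓕.infinite_setOf_SPEX_inter_EX_eq_empty,
    h𝓕.hasLinearJoinExtremal hfin, h𝓕.not_spexSubsetEventually⟩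
  · filter_upwards [eventually_ge_atTop 10] with n hn
    exact ⟨h𝓕.nonempty_EX hn, fun G hG => h𝓕.exists_abs_numEdges_sub_le_of_mem_EX hn hG⟩
  · filter_upwards [eventually_ge_atTop 10] with n hn hmod G
    exact h𝓕.mem_EX_iff_of_modEq hn hmod
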